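/- Let $A=PSL(2,\mathbb C)=SL(2,\mathbb C)/\{\pm I\}$, regarded as a complex affine algebraic group. For a finitely generated group $G$ with finite generating family $x_1,\dots,x_k$, let $R_A(G)=\mathrm{Hom}(G,A)$ be its representation variety, with the structure of an affine algebraic variety (possibly reducible) coming from the embedding $\rho\mapsto(\rho(x_1),\dots,\rho(x_k))$ onto a Zariski closed subset of $A^k$. For an algebraic variety $V$ of dimension at most $d$, let $N_i(V)$ be the number of irreducible components of $V$ of dimension exactly $i$, and let $P_d(V)=(N_d(V),N_{d-1}(V),\dots,N_0(V))$ be its profile. Theorem 4.5. Let $m,n\ge 2$ be integers, and let $\mathbb Z_m*\mathbb Z_n$ be the free product of the cyclic groups of orders $m$ and $n$. Then, for every choice of the finite generating family, $\dim R_A(\mathbb Z_m*\mathbb Z_n)=4$, and $P_4(R_A(\mathbb Z_m*\mathbb Z_n))$ equals 1. $\left(\frac{mn}{4},\,0,\,\frac{m+n}{2},\,0,\,1\right)$ if $m$ and $n$ are both even; 2. $\left(\frac{n(m-1)}{4},\,0,\,\frac{m+n-1}{2},\,0,\,1\right)$ if $m$ is odd and $n$ is even; 3. $\left(\frac{m(n-1)}{4},\,0,\,\frac{m+n-1}{2},\,0,\,1\right)$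 if $m$ is even and $n$ is odd; 4. $\left(\frac{(m-1)(n-1)}{4},\,0,\,\frac{m+n-2}{2},\,0,\,1\right)$ if $m$ and $n$ are both odd. -/

import Mathlib

open scoped MatrixGroups

noncomputable section

namespace RepProfile

/-! An affine complex algebraic variety (reducible or not) is handled as a set `X` of points with
its coordinate algebra `O`, the algebra of regular functions `X → ℂ`. -/

/-- Pullback of complex-valued functions along a map. -/
def pullback {X Y : Type*} (f : Y → X) : (X → ℂ) →ₐ[ℂ] (Y → ℂ) where
  toFun g := g ∘ f
  map_one' := rfl
  map_mul' _ _ := rfl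
  map_zero' := rfl
  map_add' _ _ := rfl
  commutes' _ := rfl

/-- The common zero set of a set of functions. -/
def zeroSet {X : Type*} (S : Set (X → ℂ)) : Set X := {x | ∀ f ∈ S, f x = 0}

/-- The Zariski topology: the closed sets are exactly the common zero sets of regular functions. -/
@[reducible] def zariskiTopology {X : Type*} (O : Subalgebra ℂ (X → ℂ)) : TopologicalSpace X :=
  TopologicalSpace.ofClosed {V | ∃ S : Set (X → ℂ), S ⊆ O ∧ V = zeroSet S}
    ⟨{1}, by simp [O.one_mem], by ext x; simp [zeroSet]⟩
    (by
      intro A hA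
      refine ⟨{f | f ∈ O ∧ ∀ x ∈ ⋂₀ A, f x = 0}, fun f hf => hf.1, ?_⟩
      ext x
      refine ⟨fun hx f hf => hf.2 x hx, fun hx V hV => ?_⟩
      obtain ⟨S, hS, rfl⟩ := hA hV
      exact fun f hf => hx f ⟨hS hf, fun y hy => hy _ hV f hf⟩)
    (by
      rintro _ ⟨S, hS, rfl⟩ _ ⟨T, hT, rfl⟩
      refine ⟨{h | ∃ f ∈ S, ∃ g ∈ T, h = f * g}, ?_, ?_⟩
      · rintro _ ⟨f, hf, g, hg, rfl⟩
        exact O.mul_mem (hS hf) (hT hg)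
      · ext x
        constructor
        · rintro (hx | hx) _ ⟨f, hf, g, hg, rfl⟩
          · simp [hx f hf]
          · simp [hx g hg]
        · intro hx
          by_contra hcon
          rw [Set.mem_union, not_or] at hcon
          obtain ⟨h1, h2⟩ := hcon
          change ¬ ∀ f ∈ S, f x = 0 at h1
          change ¬ ∀ g ∈ T, g x = 0 at h2
          push Not at h1 h2
          obtain ⟨f, hf, hfx⟩ := h1
          obtain ⟨g, hg, hgx⟩ := h2
          exact mul_ne_zero hfx hgx (hx _ ⟨f, hf, g, hg, rfl⟩))

/-- The coordinate algebra of the (closed) subset `Z`: the restrictions to `Z` of the regular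
functions. -/
def restrict {X : Type*} (O : Subalgebra ℂ (X → ℂ)) (Z : Set X) : Subalgebra ℂ (Z → ℂ) :=
  O.map (pullback (Subtype.val : Z → X))

/-- The dimension of an affine variety: the Krull dimension of its coordinate algebra. -/
def dim {X : Type*} (O : Subalgebra ℂ (X → ℂ)) : WithBot ℕ∞ := ringKrullDim O

/-- The irreducible components, for the Zariski topology. -/
def components {X : Type*} (O : Subalgebra ℂ (X → ℂ)) : Set (Set X) :=
  @irreducibleComponents X (zariskiTopology O)

/-- `N_i`: the number of irreducible components of dimension exactly `i`. -/
def numComponents {X : Type*} (O : Subalgebra ℂ (X → ℂ)) (i : ℕ) : ℕ∞ :=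
  {Z | Z ∈ components O ∧ dim (restrict O Z) = (i : WithBot ℕ∞)}.encard

/-- The profile `P_d = (N_d, N_{d-1}, …, N_0)`. -/
def profile {X : Type*} (O : Subalgebra ℂ (X → ℂ)) (d : ℕ) : Fin (d + 1) → ℕ∞ :=
  fun j => numComponents O (d - (j : ℕ))

/-- The coordinate algebra of `SL(2, ℂ) ^ ι`: the polynomial functions in the matrix entries. -/
def regularSL (ι : Type*) : Subalgebra ℂ ((ι → SL(2, ℂ)) → ℂ) :=
  Algebra.adjoin ℂ (Set.range fun (e : ι × Fin 2 × Fin 2) (s : ι → SL(2, ℂ)) =>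
    (s e.1 : Matrix (Fin 2) (Fin 2) ℂ) e.2.1 e.2.2)

/-- The coordinate algebra of `PSL(2, ℂ) ^ ι`, the quotient of `SL(2, ℂ) ^ ι` by the finite group
`{±1} ^ ι`: a function is regular when its pullback to `SL(2, ℂ) ^ ι` is. -/
def regularPSL (ι : Type*) : Subalgebra ℂ ((ι → PSL(2, ℂ)) → ℂ) :=
  (regularSL ι).comap (pullback fun (s : ι → SL(2, ℂ)) (i : ι) => (s i : PSL(2, ℂ)))

/-- The coordinate algebra of the representation variety `Hom(G, PSL(2, ℂ))`, when `x` is a finite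
generating family of `G`: the variety structure comes from the embedding
`ρ ↦ (ρ (x i))_i` of `Hom(G, PSL(2, ℂ))` onto a closed subset of `PSL(2, ℂ) ^ ι`. -/
def regularRep {G : Type*} [Group G] {ι : Type*} (x : ι → G) :
    Subalgebra ℂ ((G →* PSL(2, ℂ)) → ℂ) :=
  (regularPSL ι).map (pullback fun (ρ : G →* PSL(2, ℂ)) (i : ι) => ρ (x i))

end RepProfile

end

/-! A representation of the free product is a pair of elements of `PSL(2, ℂ)` of orders dividing `m`
and `n`. An element of order dividing `N` is the image of a conjugate of `diag(ω ^ k, ω ^ (-k))`,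
with `ω` a primitive `2N`-th root of unity and `0 ≤ k ≤ N / 2` (`exists_classParam_eq`), and the
squared trace determines `k` (`classTrSq_injOn`). Fixing the squared traces of both generators thus
splits the variety into finitely many disjoint closed pieces. Each is the image of an affine space
under a polynomial map, hence irreducible, so the pieces are the components
(`components_regularRep`).

The class `k = 0` is a point. Any other class has dimension 2: with the trace fixed, the matrix
entries are integral over the squares of the upper left entry and of the sum of the off-diagonal
entries, and these two squares take arbitrary values (Noether normalisation,
`dim_eq_card_of_isIntegral`). A component therefore has dimension twice its number of nontrivial
factors (`dim_component`). As there are `N / 2` nontrivial classes per factor, the profile is a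
count of pairs (`profile_eq`). The choice of generators is immaterial because word maps are regular
(`regularRep_eq_of_closure_eq_top`). -/

noncomputable section
namespace RepProfile

/-! ### Krull dimension under integral extensions -/

section KrullDim

variable {R S : Type*} [CommRing R] [CommRing S]

lemma ringKrullDim_le_of_isIntegral [Algebra R S] [Algebra.IsIntegral R S] :
    ringKrullDim S ≤ ringKrullDim R :=
  Order.krullDim_le_of_strictMono (PrimeSpectrum.comap (algebraMap R S)) fun _ _ h =>
    Ideal.IsIntegral.comap_lt_comap (R := R) h

/-- Going up for chains of primes: a chain lifts along an injective integral extension. -/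
lemma exists_ltSeries_comap_last_eq [Algebra R S] [Algebra.IsIntegral R S]
    (hinj : Function.Injective (algebraMap R S)) (l : LTSeries (PrimeSpectrum R)) :
    ∃ L : LTSeries (PrimeSpectrum S), L.length = l.length ∧
      PrimeSpectrum.comap (algebraMap R S) L.last = l.last := by
  induction l using RelSeries.inductionOn' with
  | singleton p =>
    obtain ⟨Q, -, hQ, hQp⟩ := Ideal.exists_ideal_over_prime_of_isIntegral p.asIdeal (⊥ : Ideal S)
      (by rw [← RingHom.ker_eq_comap_bot, (RingHom.injective_iff_ker_eq_bot _).1 hinj]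
          exact bot_le)
    exact ⟨RelSeries.singleton _ ⟨Q, hQ⟩, rfl, PrimeSpectrum.ext hQp⟩
  | snoc l p h ih =>
    obtain ⟨L, hL, hlast⟩ := ih
    have hlt : l.last < p := h
    obtain ⟨Q, hLQ, hQ, hQp⟩ := Ideal.exists_ideal_over_prime_of_isIntegral_of_isPrime p.asIdeal
      L.last.asIdeal (by
        have := congrArg PrimeSpectrum.asIdeal hlast
        rw [PrimeSpectrum.comap_asIdeal] at this
        rw [this]; exact hlt.le)
    have hQ' : PrimeSpectrum.comap (algebraMap R S) ⟨Q, hQ⟩ = p := PrimeSpectrum.ext hQp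
    refine ⟨L.snoc ⟨Q, hQ⟩ (lt_of_le_of_ne hLQ ?_), by simp [hL], by simpa using hQ'⟩
    intro he
    have he' : L.last = ⟨Q, hQ⟩ := PrimeSpectrum.ext he
    rw [← he', hlast] at hQ'
    exact hlt.ne hQ'

lemma ringKrullDim_eq_of_isIntegral [Algebra R S] [Algebra.IsIntegral R S]
    (hinj : Function.Injective (algebraMap R S)) : ringKrullDim R = ringKrullDim S := by
  refine le_antisymm (iSup_le fun l => ?_) ringKrullDim_le_of_isIntegral
  obtain ⟨L, hL, -⟩ := exists_ltSeries_comap_last_eq hinj l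
  rw [← hL]
  exact le_iSup (fun L : LTSeries (PrimeSpectrum S) => ((L.length : ℕ) : WithBot ℕ∞)) L

end KrullDim

/-! ### Criteria for dimension, irreducibility and components -/

section Criteria

open scoped Topology

variable {X Y σ τ : Type*}

/-- Noether normalisation criterion: regular functions `u j` that separate no algebraic relation
and over which all regular functions are integral compute the dimension. Integrality may be tested
after pulling back along a surjection. -/
lemma dim_eq_card_of_isIntegral [Finite σ] (O : Subalgebra ℂ (X → ℂ)) (F : Y → X)
    (hF : Function.Surjective F) (u : σ → X → ℂ) (hu : ∀ j, u j ∈ O)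
    (hsurj : ∀ z : σ → ℂ, ∃ p, ∀ j, u j p = z j)
    (hint : ∀ f ∈ O, IsIntegral (Algebra.adjoin ℂ (Set.range fun j => u j ∘ F)) (f ∘ F)) :
    dim O = (Nat.card σ : WithBot ℕ∞) := by
  let φ : MvPolynomial σ ℂ →ₐ[ℂ] O := MvPolynomial.aeval fun j => (⟨u j, hu j⟩ : O)
  have hφ : ∀ p x, (φ p : X → ℂ) x = MvPolynomial.eval (fun j => u j x) p := by
    intro p x
    induction p using MvPolynomial.induction_on with
    | C a => simp [φ]
    | add p q hp hq => simp [hp, hq]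
    | mul_X p i hp => simp [hp, φ]
  -- A relation among the `u j` is a polynomial vanishing at every point of affine space, since the
  -- `u j` jointly take all values.
  have hinj : Function.Injective φ := by
    rw [injective_iff_map_eq_zero]
    intro p hp
    refine MvPolynomial.funext fun z => ?_
    obtain ⟨x, hx⟩ := hsurj z
    have := hφ p x
    rw [hp, funext hx] at this
    simpa using this.symm
  algebraize [φ.toRingHom]
  have : Algebra.IsIntegral (MvPolynomial σ ℂ) O := by
    refine ⟨fun f => ?_⟩
    let A := Algebra.adjoin ℂ (Set.range fun j => u j ∘ F)
    let ψ : MvPolynomial σ ℂ →ₐ[ℂ] A :=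
      MvPolynomial.aeval fun j => (⟨u j ∘ F, Algebra.subset_adjoin ⟨j, rfl⟩⟩ : A)
    have hψ : ∀ p, (ψ p : Y → ℂ) = (φ p : X → ℂ) ∘ F := by
      intro p
      change (A.val.comp ψ) p = (((pullback F).comp O.val).comp φ) p
      congr 1
      refine MvPolynomial.algHom_ext fun j => ?_
      simp only [AlgHom.comp_apply, ψ, φ, MvPolynomial.aeval_X]
      rfl
    have hψs : Function.Surjective ψ := by
      rintro ⟨g, hg⟩
      have hg' : g ∈ Algebra.adjoin ℂ (Set.range fun j => u j ∘ F) := hg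
      rw [Algebra.adjoin_range_eq_range_aeval] at hg'
      obtain ⟨p, rfl⟩ := hg'
      refine ⟨p, Subtype.ext ?_⟩
      change (A.val.comp ψ) p = MvPolynomial.aeval (fun j => u j ∘ F) p
      congr 1
      refine MvPolynomial.algHom_ext fun j => ?_
      simp [ψ]
    -- Nonemptiness makes `A` nontrivial, which is needed to lift the monic equation along `ψ` to a
    -- monic one; injectivity of pullback along `F` then descends it to `O`.
    have : Nonempty Y := ⟨(hF (hsurj 0).choose).choose⟩
    obtain ⟨q, hq, hq0⟩ := hint f f.2
    obtain ⟨r, hr, -, hrm⟩ := Polynomial.lifts_and_degree_eq_and_monic (f := ψ.toRingHom)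
      (Polynomial.map_surjective ψ.toRingHom hψs q) hq
    refine ⟨r, hrm, Subtype.ext <| hF.injective_comp_right ?_⟩
    change ((pullback F).comp O.val).toRingHom (r.eval₂ φ.toRingHom f) = 0
    rw [← hq0, ← hr, Polynomial.eval₂_map, Polynomial.hom_eval₂]
    congr 1
    exact RingHom.ext fun p => (hψ p).symm
  have := ringKrullDim_eq_of_isIntegral (R := MvPolynomial σ ℂ) (S := O) hinj
  rw [dim, ← this, MvPolynomial.ringKrullDim_of_isNoetherianRing,
    ringKrullDim_eq_zero_of_field, zero_add]

lemma isClosed_zariskiTopology_iff {O : Subalgebra ℂ (X → ℂ)} {V : Set X} :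
    IsClosed[zariskiTopology O] V ↔ ∃ S : Set (X → ℂ), S ⊆ O ∧ V = zeroSet S := by
  rw [← @isOpen_compl_iff X V (zariskiTopology O)]
  change Vᶜᶜ ∈ _ ↔ _
  rw [compl_compl]
  rfl

/-- The polynomial ring is a domain: if neither closed set contained the image, two nonzero
polynomials would have product zero. -/
lemma isIrreducible_range_of_polynomial [Finite τ] (O : Subalgebra ℂ (X → ℂ)) (F : (τ → ℂ) → X)
    (hF : ∀ f ∈ O, ∃ p : MvPolynomial τ ℂ, ∀ v, f (F v) = MvPolynomial.eval v p) :
    @IsIrreducible X (zariskiTopology O) (Set.range F) := by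
  let := zariskiTopology O
  refine ⟨⟨F 0, 0, rfl⟩, ?_⟩
  rw [isPreirreducible_iff_isClosed_union_isClosed]
  intro V W hV hW hVW
  obtain ⟨S, hS, rfl⟩ := isClosed_zariskiTopology_iff.1 hV
  obtain ⟨T, hT, rfl⟩ := isClosed_zariskiTopology_iff.1 hW
  by_contra! hcon
  simp only [Set.range_subset_iff, not_forall, zeroSet, Set.mem_ofPred_eq] at hcon
  obtain ⟨⟨v, f, hf, hfv⟩, w, g, hg, hgw⟩ := hcon
  obtain ⟨p, hp⟩ := hF f (hS hf)
  obtain ⟨q, hq⟩ := hF g (hT hg)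
  have hpq : p * q = 0 := MvPolynomial.funext fun z => by
    rw [map_mul, map_zero, ← hp, ← hq]
    rcases hVW ⟨z, rfl⟩ with h | h
    · rw [h f hf, zero_mul]
    · rw [h g hg, mul_zero]
  rcases mul_eq_zero.1 hpq with rfl | rfl
  · exact hfv (by simp [hp])
  · exact hgw (by simp [hq])

/-- A finite cover by pairwise disjoint closed irreducible sets is the set of components. -/
lemma irreducibleComponents_eq_range {I : Type*} [Finite I] [TopologicalSpace X] (Z : I → Set X)
    (hcl : ∀ i, IsClosed (Z i)) (hirr : ∀ i, IsIrreducible (Z i)) (hcov : ⋃ i, Z i = Set.univ)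
    (hdisj : Pairwise (Function.onFun Disjoint Z)) :
    irreducibleComponents X = Set.range Z := by
  have key : ∀ T : Set X, IsIrreducible T → ∃ i, T ⊆ Z i := by
    intro T hT
    obtain ⟨V, hV, hTV⟩ := isIrreducible_iff_sUnion_isClosed.1 hT (Set.finite_range Z).toFinset
      (by simpa using hcl) (by simp [hcov])
    simp only [Set.Finite.mem_toFinset] at hV
    obtain ⟨i, rfl⟩ := hV
    exact ⟨i, hTV⟩
  have hmax : ∀ i, Maximal IsIrreducible (Z i) := by
    refine fun i => ⟨hirr i, fun T hT hle => ?_⟩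
    obtain ⟨j, hj⟩ := key T hT
    obtain ⟨x, hx⟩ := (hirr i).nonempty
    rcases eq_or_ne i j with rfl | hij
    · exact hj
    · exact absurd (hj (hle hx)) (Set.disjoint_left.1 (hdisj hij) hx)
  ext T
  constructor
  · intro hT
    obtain ⟨i, hi⟩ := key T hT.prop
    exact ⟨i, (hT.eq_of_subset (hirr i) hi).symm⟩
  · rintro ⟨i, rfl⟩
    exact hmax i

end Criteria

/-! ### Regular functions on representations via matrix entries -/

section Regular

variable {Y : Type*}

lemma pullback_apply {X : Type*} (f : Y → X) (g : X → ℂ) : pullback f g = g ∘ f := rfl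

/-- All matrix entries of the family `g` of matrices belong to the algebra of functions `P`. -/
def EntriesIn (P : Subalgebra ℂ (Y → ℂ)) (g : Y → SL(2, ℂ)) : Prop :=
  ∀ a b, (fun y => (g y : Matrix (Fin 2) (Fin 2) ℂ) a b) ∈ P

namespace EntriesIn

variable {P : Subalgebra ℂ (Y → ℂ)} {g h : Y → SL(2, ℂ)}

lemma const (A : SL(2, ℂ)) : EntriesIn P fun _ => A :=
  fun a b => P.algebraMap_mem ((A : Matrix (Fin 2) (Fin 2) ℂ) a b)

lemma mul (hg : EntriesIn P g) (hh : EntriesIn P h) : EntriesIn P fun y => g y * h y := by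
  intro a b
  convert! P.add_mem (P.mul_mem (hg a 0) (hh 0 b)) (P.mul_mem (hg a 1) (hh 1 b)) using 1
  funext y
  simp [Matrix.mul_apply, Fin.sum_univ_two]

lemma inv (hg : EntriesIn P g) : EntriesIn P fun y => (g y)⁻¹ := by
  have h : ∀ y, (((g y)⁻¹ : SL(2, ℂ)) : Matrix (Fin 2) (Fin 2) ℂ) =
      !![g y 1 1, -g y 0 1; -g y 1 0, g y 0 0] := fun y => by
    rw [Matrix.SpecialLinearGroup.coe_inv, Matrix.adjugate_fin_two]
  intro a b
  simp only [h]
  fin_cases a <;> fin_cases b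
  · exact hg 1 1
  · exact P.neg_mem (hg 0 1)
  · exact P.neg_mem (hg 1 0)
  · exact hg 0 0

lemma freeGroup_lift {ι : Type*} {g : Y → ι → SL(2, ℂ)} (hg : ∀ i, EntriesIn P fun y => g y i)
    (w : FreeGroup ι) : EntriesIn P fun y => FreeGroup.lift (g y) w := by
  induction w using FreeGroup.induction_on with
  | C1 => simpa using! const 1
  | of i => simpa using hg i
  | inv_of i h => simpa using (hg i).inv
  | mul v w hv hw => simpa using hv.mul hw

/-- Regular functions on `SL(2, ℂ) ^ ι`, evaluated along a family with entries in `P`, lie in `P`. -/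
lemma comp_mem {ι : Type*} {g : Y → ι → SL(2, ℂ)} (hg : ∀ i, EntriesIn P fun y => g y i)
    {f : (ι → SL(2, ℂ)) → ℂ} (hf : f ∈ regularSL ι) : f ∘ g ∈ P := by
  have h : regularSL ι ≤ P.comap (pullback g) :=
    Algebra.adjoin_le (by rintro _ ⟨e, rfl⟩; exact hg e.1 e.2.1 e.2.2)
  exact h hf

end EntriesIn

lemma entriesIn_regularSL {ι : Type*} (i : ι) :
    EntriesIn (regularSL ι) fun s : ι → SL(2, ℂ) => s i :=
  fun a b => Algebra.subset_adjoin ⟨(i, a, b), rfl⟩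

variable {G : Type*} [Group G] {ι κ : Type*}

/-- Each `y j` is a word in the `x i`, and word maps on `SL(2, ℂ)` are polynomial in the entries
because the inverse is the adjugate. -/
lemma regularRep_le_of_mem_closure {x : ι → G} {y : κ → G}
    (hy : ∀ j, y j ∈ Subgroup.closure (Set.range x)) : regularRep y ≤ regularRep x := by
  rw [← FreeGroup.range_lift_eq_closure] at hy
  choose w hw using hy
  rintro _ ⟨f, hf, rfl⟩
  refine ⟨fun A => f fun j => FreeGroup.lift A (w j), ?_, ?_⟩
  · have h := EntriesIn.comp_mem (g := fun (s : ι → SL(2, ℂ)) j => FreeGroup.lift s (w j))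
      (fun j => EntriesIn.freeGroup_lift entriesIn_regularSL (w j)) hf
    change pullback _ _ ∈ regularSL ι
    refine Set.mem_of_eq_of_mem (funext fun s => ?_) h
    simp only [RingHom.coe_coe, pullback_apply, Function.comp_apply]
    congr 1
    funext j
    exact DFunLike.congr_fun (FreeGroup.ext_hom
      (f := FreeGroup.lift fun i => ((s i : SL(2, ℂ)) : PSL(2, ℂ)))
      (g := (QuotientGroup.mk' _).comp (FreeGroup.lift s)) (by simp)) (w j)
  · refine funext fun ρ => ?_
    simp only [RingHom.coe_coe, pullback_apply, Function.comp_apply]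
    congr 1
    funext j
    rw [← hw j]
    exact DFunLike.congr_fun (FreeGroup.ext_hom (f := FreeGroup.lift fun i => ρ (x i))
      (g := ρ.comp (FreeGroup.lift x)) (by simp)) (w j)

lemma regularRep_eq_of_closure_eq_top {x : ι → G} {y : κ → G}
    (hx : Subgroup.closure (Set.range x) = ⊤) (hy : Subgroup.closure (Set.range y) = ⊤) :
    regularRep x = regularRep y :=
  le_antisymm (regularRep_le_of_mem_closure fun j => hy ▸ Subgroup.mem_top (x j))
    (regularRep_le_of_mem_closure fun j => hx ▸ Subgroup.mem_top (y j))

/-- Regular functions on `Hom(G, PSL(2, ℂ))`, evaluated along a family of representations that lifts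
to matrices with entries in `P`, lie in `P`. -/
lemma comp_mem_of_regularRep {P : Subalgebra ℂ (Y → ℂ)} {x : ι → G} {F : Y → G →* PSL(2, ℂ)}
    {g : Y → ι → SL(2, ℂ)} (hg : ∀ i, EntriesIn P fun y => g y i)
    (hF : ∀ y i, F y (x i) = (g y i : PSL(2, ℂ))) {f : (G →* PSL(2, ℂ)) → ℂ}
    (hf : f ∈ regularRep x) : f ∘ F ∈ P := by
  obtain ⟨f, hf, rfl⟩ := hf
  refine Set.mem_of_eq_of_mem (funext fun y => ?_) (EntriesIn.comp_mem hg hf)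
  change f (fun i => F y (x i)) = f fun i => (g y i : PSL(2, ℂ))
  simp only [hF]

lemma coe_eq_coe_iff {A B : SL(2, ℂ)} : (A : PSL(2, ℂ)) = B ↔ A = B ∨ A = -B := by
  rw [QuotientGroup.eq, Matrix.SpecialLinearGroup.mem_center_iff]
  constructor
  · rintro ⟨r, hr, h⟩
    have h' : (B : Matrix (Fin 2) (Fin 2) ℂ) = A * Matrix.scalar (Fin 2) r := by
      rw [h, ← Matrix.SpecialLinearGroup.coe_mul, mul_inv_cancel_left]
    replace hr : r = 1 ∨ r = -1 := by simpa using hr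
    rcases hr with rfl | rfl
    · exact .inl (Subtype.ext (by simpa using h'.symm))
    · exact .inr (neg_eq_iff_eq_neg.1 (Subtype.ext (by ext a b; simp [h'])))
  · rintro (rfl | rfl)
    · exact ⟨1, by simp⟩
    · refine ⟨-1, by simp, ?_⟩
      ext a b
      fin_cases a <;> fin_cases b <;> simp

/-- The function on `PSL(2, ℂ)` induced by an even function on `SL(2, ℂ)`. -/
def evenLift (h : SL(2, ℂ) → ℂ) (A : PSL(2, ℂ)) : ℂ := h (Quotient.out A)

lemma evenLift_coe {h : SL(2, ℂ) → ℂ} (hh : ∀ s, h (-s) = h s) (s : SL(2, ℂ)) :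
    evenLift h (s : PSL(2, ℂ)) = h s := by
  have : ((Quotient.out (s : PSL(2, ℂ)) : SL(2, ℂ)) : PSL(2, ℂ)) = s := Quotient.out_eq _
  rcases coe_eq_coe_iff.1 this with h' | h'
  · rw [evenLift, h']
  · rw [evenLift, h', hh]

lemma evenLift_mem_regularRep {h : SL(2, ℂ) → ℂ} (hh : ∀ s, h (-s) = h s) (x : ι → G) (i : ι)
    (hr : (fun s : ι → SL(2, ℂ) => h (s i)) ∈ regularSL ι) :
    (fun ρ : G →* PSL(2, ℂ) => evenLift h (ρ (x i))) ∈ regularRep x := by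
  refine ⟨fun A => evenLift h (A i), ?_, rfl⟩
  change pullback _ _ ∈ regularSL ι
  exact Set.mem_of_eq_of_mem (funext fun s => evenLift_coe hh (s i)) hr

/-- Squaring makes these functions even, so that they descend to `PSL(2, ℂ)`. The first separates
torsion classes; the other two are coordinates on a class. -/
def trSq (s : SL(2, ℂ)) : ℂ := (s 0 0 + s 1 1) ^ 2

def diagSq (s : SL(2, ℂ)) : ℂ := s 0 0 ^ 2

def offDiagSq (s : SL(2, ℂ)) : ℂ := (s 0 1 + s 1 0) ^ 2

lemma trSq_neg (s : SL(2, ℂ)) : trSq (-s) = trSq s := by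
  simp [trSq]; ring

lemma diagSq_neg (s : SL(2, ℂ)) : diagSq (-s) = diagSq s := by
  simp [diagSq]

lemma offDiagSq_neg (s : SL(2, ℂ)) : offDiagSq (-s) = offDiagSq s := by
  simp [offDiagSq]; ring

lemma trSq_mem_regularRep (x : ι → G) (i : ι) :
    (fun ρ : G →* PSL(2, ℂ) => evenLift trSq (ρ (x i))) ∈ regularRep x :=
  evenLift_mem_regularRep trSq_neg x i <| Subalgebra.pow_mem _
    (Subalgebra.add_mem _ (entriesIn_regularSL i 0 0) (entriesIn_regularSL i 1 1)) 2

lemma diagSq_mem_regularRep (x : ι → G) (i : ι) :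
    (fun ρ : G →* PSL(2, ℂ) => evenLift diagSq (ρ (x i))) ∈ regularRep x :=
  evenLift_mem_regularRep diagSq_neg x i <| Subalgebra.pow_mem _ (entriesIn_regularSL i 0 0) 2

lemma offDiagSq_mem_regularRep (x : ι → G) (i : ι) :
    (fun ρ : G →* PSL(2, ℂ) => evenLift offDiagSq (ρ (x i))) ∈ regularRep x :=
  evenLift_mem_regularRep offDiagSq_neg x i <| Subalgebra.pow_mem _
    (Subalgebra.add_mem _ (entriesIn_regularSL i 0 1) (entriesIn_regularSL i 1 0)) 2

/-- A family of matrices has integral entries as soon as its trace, the square of its upper left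
entry and the square of the sum of its off-diagonal entries are integral. -/
lemma entriesIn_integralClosure (A : Subalgebra ℂ (Y → ℂ)) {g : Y → SL(2, ℂ)}
    (htr : IsIntegral A fun y => trSq (g y)) (hd : IsIntegral A fun y => diagSq (g y))
    (ho : IsIntegral A fun y => offDiagSq (g y)) :
    EntriesIn ((integralClosure A (Y → ℂ)).restrictScalars ℂ) g := by
  set B := (integralClosure A (Y → ℂ)).restrictScalars ℂ
  let e : Fin 2 → Fin 2 → Y → ℂ := fun a b y => g y a b
  have htr' : e 0 0 + e 1 1 ∈ B := IsIntegral.of_pow two_pos htr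
  have h00 : e 0 0 ∈ B := IsIntegral.of_pow two_pos hd
  have h11 : e 1 1 ∈ B := by simpa using B.sub_mem htr' h00
  have ho' : e 0 1 + e 1 0 ∈ B := IsIntegral.of_pow two_pos ho
  -- Writing the entries as `a, b, c, d`, the determinant gives `bc = ad - 1`, so `(b - c)² = (b +
  -- c)² - 4bc` is integral, and hence so is `b - c`.
  have hm : e 0 1 - e 1 0 ∈ B := by
    refine IsIntegral.of_pow two_pos (?_ : (e 0 1 - e 1 0) ^ 2 ∈ B)
    have h4 : (e 0 1 - e 1 0) ^ 2 = (e 0 1 + e 1 0) ^ 2 - (4 : ℂ) • (e 0 0 * e 1 1 - 1) := by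
      funext y
      have := (g y).det_coe
      rw [Matrix.det_fin_two] at this
      simp only [e, Pi.pow_apply, Pi.sub_apply, Pi.add_apply, Pi.smul_apply, Pi.mul_apply,
        Pi.one_apply, smul_eq_mul]
      linear_combination 4 * this
    rw [h4]
    exact B.sub_mem (B.pow_mem ho' 2) (B.smul_mem (B.sub_mem (B.mul_mem h00 h11) B.one_mem) 4)
  have h01 : e 0 1 ∈ B := by
    convert! B.smul_mem (B.add_mem ho' hm) (1 / 2 : ℂ) using 1
    funext y; simp; ring
  have h10 : e 1 0 ∈ B := by
    convert! B.smul_mem (B.sub_mem ho' hm) (1 / 2 : ℂ) using 1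
    funext y; simp; ring
  intro a b
  fin_cases a <;> fin_cases b
  exacts [h00, h01, h10, h11]

end Regular

/-! ### Polynomial parametrisation of semisimple conjugacy classes -/

section Conjugacy

def lowerUnip (w : ℂ) : SL(2, ℂ) := ⟨!![1, 0; w, 1], by simp [Matrix.det_fin_two]⟩

def upperUnip (w : ℂ) : SL(2, ℂ) := ⟨!![1, w; 0, 1], by simp [Matrix.det_fin_two]⟩

lemma sl_mul_apply (A B : SL(2, ℂ)) (a b : Fin 2) :
    (A * B) a b = A a 0 * B 0 b + A a 1 * B 1 b := by
  rw [Matrix.SpecialLinearGroup.coe_mul, Matrix.mul_apply, Fin.sum_univ_two]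

lemma sl_inv_apply (A : SL(2, ℂ)) : ((A⁻¹ : SL(2, ℂ)) : Matrix (Fin 2) (Fin 2) ℂ) =
    !![A 1 1, -A 0 1; -A 1 0, A 0 0] := by
  rw [Matrix.SpecialLinearGroup.coe_inv, Matrix.adjugate_fin_two]

lemma sl_ext {A B : SL(2, ℂ)} (h00 : A 0 0 = B 0 0) (h01 : A 0 1 = B 0 1) (h10 : A 1 0 = B 1 0)
    (h11 : A 1 1 = B 1 1) : A = B := by
  refine Subtype.ext (Matrix.ext fun a b => ?_)
  fin_cases a <;> fin_cases b
  exacts [h00, h01, h10, h11]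

lemma sl_det (A : SL(2, ℂ)) : A 0 0 * A 1 1 - A 0 1 * A 1 0 = 1 := by
  rw [← Matrix.det_fin_two, A.det_coe]

def torusMk (z : ℂˣ) : SL(2, ℂ) := ⟨!![(z : ℂ), 0; 0, (z⁻¹ : ℂˣ)], by simp [Matrix.det_fin_two]⟩

lemma torusMk_coe (z : ℂˣ) :
    (torusMk z : Matrix (Fin 2) (Fin 2) ℂ) = !![(z : ℂ), 0; 0, (z⁻¹ : ℂˣ)] := rfl

def torus : ℂˣ →* SL(2, ℂ) where
  toFun := torusMk
  map_one' := by apply sl_ext <;> simp [torusMk_coe]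
  map_mul' y z := by
    apply sl_ext <;> simp only [sl_mul_apply, torusMk_coe] <;> simp [mul_comm]

lemma torus_coe (z : ℂˣ) :
    (torus z : Matrix (Fin 2) (Fin 2) ℂ) = !![(z : ℂ), 0; 0, (z⁻¹ : ℂˣ)] := rfl

lemma lowerUnip_coe (w : ℂ) : (lowerUnip w : Matrix (Fin 2) (Fin 2) ℂ) = !![1, 0; w, 1] := rfl

lemma upperUnip_coe (w : ℂ) : (upperUnip w : Matrix (Fin 2) (Fin 2) ℂ) = !![1, w; 0, 1] := rfl

lemma tr_conj (P A : SL(2, ℂ)) :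
    (P * A * P⁻¹) 0 0 + (P * A * P⁻¹) 1 1 = A 0 0 + A 1 1 := by
  simp only [sl_mul_apply, sl_inv_apply]
  simp only [Matrix.of_apply, Matrix.cons_val', Matrix.cons_val_zero, Matrix.cons_val_one,
    Matrix.cons_val_fin_one]
  linear_combination (A 0 0 + A 1 1) * sl_det P

/-- The product of unipotents parametrising an open subset of `SL(2, ℂ)` modulo the torus. -/
def unipProd (v : Fin 3 → ℂ) : SL(2, ℂ) := lowerUnip (v 0) * upperUnip (v 1) * lowerUnip (v 2)

/-- A polynomial parametrisation of the conjugacy class of the diagonal matrix `torus z`. -/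
def conjParam (z : ℂˣ) (v : Fin 3 → ℂ) : SL(2, ℂ) := unipProd v * torus z * (unipProd v)⁻¹

lemma entriesIn_conjParam {Y : Type*} {P : Subalgebra ℂ (Y → ℂ)} {v : Y → Fin 3 → ℂ}
    (hv : ∀ j, (fun y => v y j) ∈ P) (z : ℂˣ) : EntriesIn P fun y => conjParam z (v y) := by
  have hl : ∀ j, EntriesIn P fun y => lowerUnip (v y j) := by
    intro j a b
    fin_cases a <;> fin_cases b
    exacts [P.one_mem, P.zero_mem, hv j, P.one_mem]
  have hu : ∀ j, EntriesIn P fun y => upperUnip (v y j) := by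
    intro j a b
    fin_cases a <;> fin_cases b
    exacts [P.one_mem, hv j, P.zero_mem, P.one_mem]
  have h := ((hl 0).mul (hu 1)).mul (hl 2)
  exact (h.mul (.const _)).mul h.inv

lemma conjParam_pow (z : ℂˣ) (v : Fin 3 → ℂ) (N : ℕ) :
    conjParam z v ^ N = conjParam (z ^ N) v := by
  rw [conjParam, conj_pow, conjParam, map_pow]

lemma conjParam_one (v : Fin 3 → ℂ) : conjParam 1 v = 1 := by
  simp [conjParam]

lemma conjParam_neg_one (v : Fin 3 → ℂ) : conjParam (-1) v = -1 := by
  have : torus (-1) = -1 := by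
    apply sl_ext <;> simp [torus_coe]
  rw [conjParam, this]
  simp

lemma conjParam_tr (z : ℂˣ) (v : Fin 3 → ℂ) :
    (conjParam z v) 0 0 + (conjParam z v) 1 1 = z + (z⁻¹ : ℂˣ) := by
  rw [conjParam, tr_conj, torus_coe]
  simp

/-- A matrix with nonzero lower left entry is determined up to two unipotent conjugations by its
trace. -/
lemma exists_conj_eq_of_ne_zero {z : ℂˣ} {A : SL(2, ℂ)} (hz : z ^ 2 ≠ 1)
    (htr : A 0 0 + A 1 1 = z + (z⁻¹ : ℂˣ)) (hc : A 1 0 ≠ 0) :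
    ∃ p q : ℂ, A = upperUnip p * lowerUnip q * torus z * (upperUnip p * lowerUnip q)⁻¹ := by
  have hz' : (z : ℂ) - (z⁻¹ : ℂˣ) ≠ 0 := by
    rw [sub_ne_zero, Ne, Units.val_inj, eq_inv_iff_mul_eq_one, ← sq]
    exact hz
  have hzz : (z : ℂ) * (z⁻¹ : ℂˣ) = 1 := by simp
  have hdet := sl_det A
  -- The columns `(1 + pq, q)` and `(p, 1)` of the conjugating matrix must be eigenvectors of `A`
  -- for `z` and `z⁻¹`; this determines `p`, then `q`.
  refine ⟨(A 0 0 - z) / A 1 0, A 1 0 / (z - (z⁻¹ : ℂˣ)), ?_⟩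
  rw [eq_mul_inv_iff_mul_eq]
  apply sl_ext <;> simp only [sl_mul_apply, torus_coe, lowerUnip_coe, upperUnip_coe] <;>
    simp only [Matrix.of_apply, Matrix.cons_val', Matrix.cons_val_zero, Matrix.cons_val_one,
      Matrix.cons_val_fin_one] <;>
    generalize ((z⁻¹ : ℂˣ) : ℂ) = z' at * <;> generalize (z : ℂ) = y at * <;>
    generalize A 0 0 = a at * <;> generalize A 0 1 = b at * <;> generalize A 1 0 = c at * <;>
    generalize A 1 1 = d at * <;>
    obtain rfl := eq_sub_of_add_eq' htr <;> field_simp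
  · linear_combination c * (hzz - hdet)
  · linear_combination (y - z') * (hzz - hdet)
  · ring
  · ring

/-- Since `z ^ 2 ≠ 1`, `A` is not scalar, so some lower unipotent conjugation makes its lower left
entry nonzero. This is why three unipotent factors suffice. -/
lemma exists_conjParam_eq {z : ℂˣ} {A : SL(2, ℂ)} (hz : z ^ 2 ≠ 1)
    (htr : A 0 0 + A 1 1 = z + (z⁻¹ : ℂˣ)) : ∃ v, conjParam z v = A := by
  obtain ⟨w, hw⟩ : ∃ w : ℂ, (lowerUnip w * A * (lowerUnip w)⁻¹) 1 0 ≠ 0 := by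
    have h : ∀ w, (lowerUnip w * A * (lowerUnip w)⁻¹) 1 0 =
        A 1 0 + w * (A 0 0 - A 1 1) - w ^ 2 * A 0 1 := by
      intro w
      simp only [sl_mul_apply, sl_inv_apply, lowerUnip_coe]
      simp
      ring
    simp only [h]
    -- The entry is quadratic in `w`; its vanishing at `0`, `1` and `-1` would make `A` scalar,
    -- whence `(z - z⁻¹)² = 0`.
    by_contra! hcon
    have h0 := hcon 0
    have h1 := hcon 1
    have h2 := hcon (-1)
    have hdet := sl_det A
    have hc : A 1 0 = 0 := by linear_combination h0
    have hb : A 0 1 = 0 := by linear_combination h0 - (h1 + h2) / 2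
    have had : A 0 0 = A 1 1 := by linear_combination (h1 - h2) / 2
    have hzz : (z : ℂ) * (z⁻¹ : ℂˣ) = 1 := by simp
    rw [hb, had] at hdet
    rw [had] at htr
    have h4 : ((z : ℂ) - (z⁻¹ : ℂˣ)) ^ 2 = 0 := by
      linear_combination 4 * hdet - 4 * hzz - (A 1 1 + A 1 1 + z + (z⁻¹ : ℂˣ)) * htr
    refine hz ?_
    rw [sq, ← eq_inv_iff_mul_eq_one, ← Units.val_inj]
    exact sub_eq_zero.1 (pow_eq_zero_iff two_ne_zero |>.1 h4)
  obtain ⟨p, q, h⟩ := exists_conj_eq_of_ne_zero (A := lowerUnip w * A * (lowerUnip w)⁻¹) hz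
    (by rw [tr_conj, htr]) hw
  have hinv : lowerUnip (-w) = (lowerUnip w)⁻¹ := by
    apply sl_ext <;> simp only [sl_inv_apply, lowerUnip_coe] <;> simp
  refine ⟨![-w, p, q], ?_⟩
  have : A = (lowerUnip w)⁻¹ * (lowerUnip w * A * (lowerUnip w)⁻¹) * lowerUnip w := by group
  rw [this, h, conjParam, unipProd]
  simp only [Matrix.cons_val_zero, Matrix.cons_val_one, Matrix.cons_val, hinv]
  group

end Conjugacy

/-! ### Classification of torsion elements by squared trace -/

section Torsion

variable {N : ℕ}

/-- A primitive root of unity of order `2 * N`. -/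
def halfRoot (N : ℕ) : ℂˣ :=
  Units.mk0 (Complex.exp (2 * Real.pi * Complex.I / (2 * N : ℕ))) (Complex.exp_ne_zero _)

lemma isPrimitiveRoot_halfRoot (hN : N ≠ 0) : IsPrimitiveRoot (halfRoot N) (2 * N) :=
  IsPrimitiveRoot.coe_units_iff.1 (Complex.isPrimitiveRoot_exp (2 * N) (by simp [hN]))

lemma sq_eq_one_iff_units {z : ℂˣ} : z ^ 2 = 1 ↔ z = 1 ∨ z = -1 := by
  rw [← Units.val_inj, ← Units.val_inj, ← Units.val_inj]
  simp

/-- The conjugacy classes of elements of order dividing `N` in `PSL(2, ℂ)`, indexed by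
`k ≤ N / 2`. -/
def classParam (N k : ℕ) (v : Fin 3 → ℂ) : SL(2, ℂ) := conjParam (halfRoot N ^ k) v

/-- The squared trace of the class `classParam N k`. -/
def classTrSq (N k : ℕ) : ℂ := (((halfRoot N ^ k : ℂˣ) : ℂ) + ((halfRoot N ^ k)⁻¹ : ℂˣ)) ^ 2

lemma trSq_classParam (k : ℕ) (v : Fin 3 → ℂ) : trSq (classParam N k v) = classTrSq N k := by
  rw [trSq, classParam, conjParam_tr, classTrSq]

lemma coe_conjParam_pow_eq_one {z : ℂˣ} (hz : (z ^ N) ^ 2 = 1) (v : Fin 3 → ℂ) :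
    ((conjParam z v : SL(2, ℂ)) : PSL(2, ℂ)) ^ N = 1 := by
  rw [← QuotientGroup.mk_pow, conjParam_pow, ← QuotientGroup.mk_one, coe_eq_coe_iff]
  rcases sq_eq_one_iff_units.1 hz with h | h
  · rw [h, conjParam_one]; exact .inl rfl
  · rw [h, conjParam_neg_one]; exact .inr rfl

lemma coe_classParam_pow (hN : N ≠ 0) (k : ℕ) (v : Fin 3 → ℂ) :
    ((classParam N k v : SL(2, ℂ)) : PSL(2, ℂ)) ^ N = 1 := by
  refine coe_conjParam_pow_eq_one ?_ v
  rw [← pow_mul, ← pow_mul, show k * (N * 2) = 2 * N * k by ring, pow_mul,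
    (isPrimitiveRoot_halfRoot hN).pow_eq_one, one_pow]

/-- With `y = ω ^ k` and `z = ω ^ l`, clearing denominators gives `(y² - z²)(y²z² - 1) = 0`. The
first factor gives `k = l` directly; the second gives `N ∣ k + l`, and the bound `N / 2` leaves only
`k = l = 0` or `k = l = N / 2`. -/
lemma classTrSq_injOn (hN : N ≠ 0) {k l : ℕ} (hk : k ≤ N / 2) (hl : l ≤ N / 2)
    (h : classTrSq N k = classTrSq N l) : k = l := by
  have hω := isPrimitiveRoot_halfRoot hN
  have hprod : ((((halfRoot N ^ k) ^ 2 : ℂˣ) : ℂ) - ((halfRoot N ^ l) ^ 2 : ℂˣ)) *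
      (((halfRoot N ^ k) ^ 2 * (halfRoot N ^ l) ^ 2 : ℂˣ) - 1) = 0 := by
    have e : ∀ z : ℂˣ, ((z : ℂ) + (z⁻¹ : ℂˣ)) ^ 2 * (z : ℂ) ^ 2 = ((z : ℂ) ^ 2 + 1) ^ 2 := by
      intro z
      have : (z : ℂ) * (z⁻¹ : ℂˣ) = 1 := by simp
      rw [← mul_pow]
      congr 1
      linear_combination this
    have ek := e (halfRoot N ^ k)
    have el := e (halfRoot N ^ l)
    rw [← classTrSq] at ek el
    rw [← h] at el
    simp only [Units.val_mul, Units.val_pow_eq_pow_val] at ek el ⊢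
    linear_combination ((halfRoot N : ℂ) ^ k) ^ 2 * el - ((halfRoot N : ℂ) ^ l) ^ 2 * ek
  rcases mul_eq_zero.1 hprod with h0 | h0
  · have := Units.val_inj.1 (sub_eq_zero.1 h0)
    rw [← pow_mul, ← pow_mul] at this
    have := hω.pow_inj (by omega) (by omega) this
    omega
  · have : (halfRoot N ^ k) ^ 2 * (halfRoot N ^ l) ^ 2 = 1 := by
      rw [← Units.val_inj, Units.val_one]; exact sub_eq_zero.1 h0
    rw [← mul_pow, ← pow_add, ← pow_mul, hω.pow_eq_one_iff_dvd] at this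
    obtain ⟨c, hc⟩ := this
    rcases c with _ | _ | c
    · omega
    · omega
    · have : 2 * N * 2 ≤ 2 * N * (c + 1 + 1) := Nat.mul_le_mul_left _ (by omega)
      omega

lemma classParam_sq_ne_one (hN : N ≠ 0) {k : ℕ} (hk : k ≤ N / 2) (hk0 : k ≠ 0) :
    (halfRoot N ^ k) ^ 2 ≠ 1 := by
  rw [← pow_mul, Ne, (isPrimitiveRoot_halfRoot hN).pow_eq_one_iff_dvd]
  intro h
  have := Nat.le_of_dvd (by omega) h
  omega

lemma exists_add_inv_eq (t : ℂ) : ∃ z : ℂˣ, (z : ℂ) + (z⁻¹ : ℂˣ) = t := by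
  obtain ⟨s, hs⟩ := IsAlgClosed.exists_pow_nat_eq (t ^ 2 - 4) two_pos
  have h : (t + s) / 2 * ((t - s) / 2) = 1 := by linear_combination (-1 / 4) * hs
  refine ⟨⟨(t + s) / 2, (t - s) / 2, h, by rw [mul_comm, h]⟩, ?_⟩
  rw [Units.inv_mk]
  ring

/-- A matrix with trace `2` and with a power that is central is trivial. -/
lemma eq_one_of_pow_eq (hN : N ≠ 0) {A : SL(2, ℂ)} (htr : A 0 0 + A 1 1 = 2)
    (hA : (A : PSL(2, ℂ)) ^ N = 1) : A = 1 := by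
  have hdet := sl_det A
  -- By Cayley–Hamilton `A² = 2A - 1`, so `A ^ n = nA - (n - 1)`; if this is scalar for `n = N ≠ 0`,
  -- then so is `A`.
  have hpow : ∀ n : ℕ, (A ^ n) 0 0 = n * A 0 0 - (n - 1) ∧ (A ^ n) 0 1 = n * A 0 1 ∧
      (A ^ n) 1 0 = n * A 1 0 ∧ (A ^ n) 1 1 = n * A 1 1 - (n - 1) := by
    intro n
    induction n with
    | zero => simp
    | succ n ih =>
      obtain ⟨h1, h2, h3, h4⟩ := ih
      simp only [pow_succ, sl_mul_apply, h1, h2, h3, h4, Nat.cast_add, Nat.cast_one]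
      refine ⟨?_, ?_, ?_, ?_⟩
      · linear_combination n * A 0 0 * htr - n * hdet
      · linear_combination n * A 0 1 * htr
      · linear_combination n * A 1 0 * htr
      · linear_combination n * A 1 1 * htr - n * hdet
  obtain ⟨h1, h2, h3, h4⟩ := hpow N
  have hN' : (N : ℂ) ≠ 0 := Nat.cast_ne_zero.2 hN
  rw [← QuotientGroup.mk_pow, ← QuotientGroup.mk_one, coe_eq_coe_iff] at hA
  have key : (A ^ N) 0 1 = 0 ∧ (A ^ N) 1 0 = 0 ∧ (A ^ N) 0 0 = (A ^ N) 1 1 := by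
    rcases hA with hA | hA <;> rw [hA] <;> simp
  obtain ⟨k1, k2, k3⟩ := key
  have e1 : A 0 1 = 0 := by simpa [hN', k1] using h2.symm
  have e2 : A 1 0 = 0 := by simpa [hN', k2] using h3.symm
  have e3 : A 0 0 = A 1 1 := by
    have : (N : ℂ) * (A 0 0 - A 1 1) = 0 := by linear_combination k3 - h1 + h4
    exact sub_eq_zero.1 ((mul_eq_zero.1 this).resolve_left hN')
  apply sl_ext
  · simp; linear_combination (htr + e3) / 2
  · simpa using e1
  · simpa using e2
  · simp; linear_combination (htr - e3) / 2

/-- Here `z = ω ^ j` with `j < 2N`. The substitutions `z ↦ -z` (a shift by `N`, as `ω ^ N = -1`) and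
`z ↦ z⁻¹`, harmless in `PSL(2, ℂ)` up to conjugacy, fold this range onto `0, …, N / 2`. -/
lemma exists_pow_half (hN : N ≠ 0) {z : ℂˣ} (hz : (z ^ N) ^ 2 = 1) :
    ∃ k ≤ N / 2, z = halfRoot N ^ k ∨ z = -halfRoot N ^ k ∨ z⁻¹ = halfRoot N ^ k ∨
      z⁻¹ = -halfRoot N ^ k := by
  have hω := isPrimitiveRoot_halfRoot hN
  have hωN : halfRoot N ^ N = -1 := by
    have h1 : (halfRoot N ^ N) ^ 2 = 1 := by rw [← pow_mul, mul_comm, hω.pow_eq_one]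
    refine (sq_eq_one_iff_units.1 h1).resolve_left fun h => ?_
    have := Nat.le_of_dvd (by omega) (hω.pow_eq_one_iff_dvd N |>.1 h)
    omega
  have : NeZero (2 * N) := ⟨by omega⟩
  obtain ⟨j, hj, hjz⟩ := (IsPrimitiveRoot.coe_units_iff.2 hω).eq_pow_of_pow_eq_one (ξ := (z : ℂ)) (by
    rw [mul_comm, pow_mul, ← Units.val_pow_eq_pow_val, ← Units.val_pow_eq_pow_val, hz,
      Units.val_one])
  obtain rfl : halfRoot N ^ j = z := by rw [← Units.val_inj, Units.val_pow_eq_pow_val, hjz]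
  rcases le_or_gt j (N / 2) with h1 | h1
  · exact ⟨j, h1, .inl rfl⟩
  rcases le_or_gt j N with h2 | h2
  · refine ⟨N - j, by omega, .inr (.inr (.inr ?_))⟩
    rw [inv_eq_iff_mul_eq_one, mul_neg, ← pow_add, Nat.add_sub_cancel' h2, hωN, neg_neg]
  rcases le_or_gt (j - N) (N / 2) with h3 | h3
  · refine ⟨j - N, h3, .inr (.inl ?_)⟩
    rw [← neg_one_mul, ← hωN, ← pow_add, Nat.add_sub_cancel' h2.le]
  · refine ⟨2 * N - j, by omega, .inr (.inr (.inl ?_))⟩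
    rw [inv_eq_iff_mul_eq_one, ← pow_add, Nat.add_sub_cancel' hj.le, hω.pow_eq_one]

lemma sq_eq_one_of_add_inv_sq {w : ℂˣ} (h : ((w : ℂ) + (w⁻¹ : ℂˣ)) ^ 2 = 4) : w ^ 2 = 1 := by
  have hw : (w : ℂ) * (w⁻¹ : ℂˣ) = 1 := by simp
  have : ((w : ℂ) - (w⁻¹ : ℂˣ)) ^ 2 = 0 := by linear_combination h - 4 * hw
  rw [sq, ← eq_inv_iff_mul_eq_one, ← Units.val_inj]
  exact sub_eq_zero.1 (pow_eq_zero_iff two_ne_zero |>.1 this)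

lemma coe_neg (A : SL(2, ℂ)) : ((-A : SL(2, ℂ)) : PSL(2, ℂ)) = A :=
  coe_eq_coe_iff.2 (.inr rfl)

/-- Let `z`, `z⁻¹` be the eigenvalues of a lift. If `z ^ 2 = 1`, torsion excludes nontrivial
unipotents and `A` is trivial; otherwise the lift is diagonalisable and `exists_pow_half` normalises
`z`. -/
lemma exists_classParam_eq (hN : N ≠ 0) {A : PSL(2, ℂ)} (hA : A ^ N = 1) :
    ∃ k ≤ N / 2, ∃ v, ((classParam N k v : SL(2, ℂ)) : PSL(2, ℂ)) = A := by
  obtain ⟨A, rfl⟩ := QuotientGroup.mk_surjective A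
  obtain ⟨z, hz⟩ := exists_add_inv_eq (A 0 0 + A 1 1)
  by_cases hz1 : z ^ 2 = 1
  · refine ⟨0, Nat.zero_le _, 0, ?_⟩
    rw [classParam, pow_zero, conjParam_one]
    rcases sq_eq_one_iff_units.1 hz1 with rfl | rfl
    · rw [eq_one_of_pow_eq hN (by rw [← hz]; norm_num) hA]
    · have := eq_one_of_pow_eq (A := -A) hN
        (by simp only [Matrix.SpecialLinearGroup.coe_neg, Matrix.neg_apply]
            rw [← neg_add, ← hz]; norm_num) (by rw [coe_neg]; exact hA)
      rw [← this]
      exact coe_neg A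
  · obtain ⟨v, rfl⟩ := exists_conjParam_eq hz1 hz.symm
    have hzN : (z ^ N) ^ 2 = 1 := by
      rw [← QuotientGroup.mk_pow, ← QuotientGroup.mk_one, coe_eq_coe_iff, conjParam_pow] at hA
      -- The `N`-th power is `±1`, so its trace `z ^ N + z ^ (-N)` is `±2`.
      refine sq_eq_one_of_add_inv_sq ?_
      rw [← conjParam_tr (z ^ N) v]
      rcases hA with h | h <;> rw [h] <;> norm_num
    obtain ⟨k, hk, h⟩ := exists_pow_half hN hzN
    -- Only the trace is kept: after changing sign or inverting the eigenvalue, the matrix is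
    -- parametrised anew.
    generalize conjParam z v = A at hz ⊢
    refine ⟨k, hk, ?_⟩
    unfold classParam
    generalize halfRoot N ^ k = w at h ⊢
    have hpos : ∀ B : SL(2, ℂ), (B : PSL(2, ℂ)) = A → w ^ 2 ≠ 1 →
        B 0 0 + B 1 1 = w + (w⁻¹ : ℂˣ) → ∃ v, (conjParam w v : PSL(2, ℂ)) = A := by
      intro B hB hw htr
      obtain ⟨v, rfl⟩ := exists_conjParam_eq hw htr
      exact ⟨v, hB⟩
    have hnegtr : (-A) 0 0 + (-A) 1 1 = -((z : ℂ) + (z⁻¹ : ℂˣ)) := by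
      simp only [Matrix.SpecialLinearGroup.coe_neg, Matrix.neg_apply, hz]
      ring
    rcases h with rfl | rfl | rfl | h
    · exact hpos A rfl hz1 hz.symm
    · refine hpos (-A) (coe_neg A) (by simpa using hz1) ?_
      rw [hnegtr]
      simp [add_comm]
    · refine hpos A rfl (by simpa using hz1) ?_
      rw [← hz, inv_inv, add_comm]
    · obtain rfl : w = -z⁻¹ := by rw [h, neg_neg]
      refine hpos (-A) (coe_neg A) (by simpa using hz1) ?_
      rw [hnegtr]
      simp [add_comm, inv_neg]

lemma exists_classParam_eq_of_trSq (hN : N ≠ 0) {A : PSL(2, ℂ)} (hA : A ^ N = 1) {k : ℕ}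
    (hk : k ≤ N / 2) (h : evenLift trSq A = classTrSq N k) :
    ∃ v, ((classParam N k v : SL(2, ℂ)) : PSL(2, ℂ)) = A := by
  obtain ⟨l, hl, v, rfl⟩ := exists_classParam_eq hN hA
  rw [evenLift_coe trSq_neg, trSq_classParam] at h
  rw [classTrSq_injOn hN hk hl h.symm]
  exact ⟨v, rfl⟩

end Torsion

/-! ### Components of the representation variety and their dimensions -/

section Components

open scoped Topology

variable {G : Type*} [Group G] {ι : Type*}

/-- Homomorphisms to `PSL(2, ℂ)` amount to families of elements of order dividing `N i`: the
property of the generating family `x` of a free product of cyclic groups used below. -/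
structure IsCyclicFreeBasis (x : ι → G) (N : ι → ℕ) : Prop where
  two_le : ∀ i, 2 ≤ N i
  pow_eq_one : ∀ i, x i ^ N i = 1
  hom_ext : ∀ ρ σ : G →* PSL(2, ℂ), (∀ i, ρ (x i) = σ (x i)) → ρ = σ
  exists_hom : ∀ A : ι → PSL(2, ℂ), (∀ i, A i ^ N i = 1) → ∃ ρ : G →* PSL(2, ℂ), ∀ i, ρ (x i) = A i

/-- The representations with prescribed squared traces on the family `x`. -/
def component (x : ι → G) (N k : ι → ℕ) : Set (G →* PSL(2, ℂ)) :=
  {ρ | ∀ i, evenLift trSq (ρ (x i)) = classTrSq (N i) (k i)}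

lemma isClosed_component (x : ι → G) (N k : ι → ℕ) :
    IsClosed[zariskiTopology (regularRep x)] (component x N k) := by
  rw [isClosed_zariskiTopology_iff]
  refine ⟨Set.range fun (i : ι) (ρ : G →* PSL(2, ℂ)) =>
    evenLift trSq (ρ (x i)) - classTrSq (N i) (k i), ?_, ?_⟩
  · rintro _ ⟨i, rfl⟩
    exact Subalgebra.sub_mem _ (trSq_mem_regularRep x i) (Subalgebra.algebraMap_mem _ _)
  · ext ρ
    simp [component, zeroSet, sub_eq_zero]

lemma exists_matrix (t α β : ℂ) :
    ∃ A : SL(2, ℂ), A 0 0 + A 1 1 = t ∧ diagSq A = α ∧ offDiagSq A = β := by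
  obtain ⟨a, ha⟩ := IsAlgClosed.exists_pow_nat_eq α two_pos
  obtain ⟨u, hu⟩ := IsAlgClosed.exists_pow_nat_eq β two_pos
  -- With `u` as the sum of the off-diagonal entries, `v` is their difference, chosen so that the
  -- determinant is `1`.
  obtain ⟨v, hv⟩ := IsAlgClosed.exists_pow_nat_eq (u ^ 2 - 4 * (a * (t - a) - 1)) two_pos
  refine ⟨⟨!![a, (u + v) / 2; (u - v) / 2, t - a], ?_⟩, ?_, ?_, ?_⟩
  · rw [Matrix.det_fin_two_of]
    linear_combination hv / 4
  · simp
  · simpa [diagSq] using ha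
  · simp only [offDiagSq]
    simp
    rw [← hu]
    ring

/-- The coordinates giving the Noether normalisation. -/
def coord (x : ι → G) (e : ι × Bool) (ρ : G →* PSL(2, ℂ)) : ℂ :=
  evenLift (bif e.2 then diagSq else offDiagSq) (ρ (x e.1))

lemma coord_mem (x : ι → G) (e : ι × Bool) : coord x e ∈ regularRep x := by
  obtain ⟨i, _ | _⟩ := e
  exacts [offDiagSq_mem_regularRep x i, diagSq_mem_regularRep x i]

lemma isIntegral_of_eq {Y : Type*} {A : Subalgebra ℂ (Y → ℂ)} {f : Y → ℂ} (hf : f ∈ A) :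
    IsIntegral A f :=
  isIntegral_algebraMap (x := (⟨f, hf⟩ : A))

lemma isIntegral_of_finite_values {Y : Type*} (A : Subalgebra ℂ (Y → ℂ)) {f : Y → ℂ}
    (s : Finset ℂ) (hf : ∀ y, f y ∈ s) : IsIntegral A f := by
  refine ⟨∏ c ∈ s, (Polynomial.X - Polynomial.C (algebraMap ℂ A c)),
    Polynomial.monic_prod_of_monic _ _ fun c _ => Polynomial.monic_X_sub_C _, ?_⟩
  rw [Polynomial.eval₂_finsetProd]
  funext y
  rw [Finset.prod_apply]
  refine Finset.prod_eq_zero (hf y) ?_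
  simp only [Polynomial.eval₂_sub, Polynomial.eval₂_X, Polynomial.eval₂_C]
  exact sub_self _

/-- Families of matrices whose entries are integral over the coordinates. -/
lemma entriesIn_of_coord {Y : Type*} {x : ι → G} {F : Y → G →* PSL(2, ℂ)}
    {g : Y → ι → SL(2, ℂ)} (hF : ∀ y i, F y (x i) = (g y i : PSL(2, ℂ)))
    {A : Subalgebra ℂ (Y → ℂ)} (i : ι) (hA : ∀ b, coord x (i, b) ∘ F ∈ A)
    (s : Finset ℂ) (hs : ∀ y, trSq (g y i) ∈ s) :
    EntriesIn ((integralClosure A (Y → ℂ)).restrictScalars ℂ) fun y => g y i := by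
  refine entriesIn_integralClosure A (isIntegral_of_finite_values A s hs)
    (isIntegral_of_eq ?_) (isIntegral_of_eq ?_)
  · refine Set.mem_of_eq_of_mem (funext fun y => ?_) (hA true)
    simp only [Function.comp_apply, coord, hF, cond_true]
    rw [evenLift_coe diagSq_neg]
  · refine Set.mem_of_eq_of_mem (funext fun y => ?_) (hA false)
    simp only [Function.comp_apply, coord, hF, cond_false]
    rw [evenLift_coe offDiagSq_neg]

namespace IsCyclicFreeBasis

variable {x : ι → G} {N : ι → ℕ} (h : IsCyclicFreeBasis x N)

include h

lemma ne_zero (i : ι) : N i ≠ 0 := by have := h.two_le i; omega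

/-- The parametrisation of a component by an affine space. -/
lemma exists_param (k : ι → ℕ) : ∃ F : (ι × Fin 3 → ℂ) → G →* PSL(2, ℂ), ∀ v i,
    F v (x i) = (classParam (N i) (k i) fun j => v (i, j) : SL(2, ℂ)) := by
  choose F hF using fun v : ι × Fin 3 → ℂ =>
    h.exists_hom (fun i => (classParam (N i) (k i) fun j => v (i, j) : SL(2, ℂ)))
      fun i => coe_classParam_pow (h.ne_zero i) _ _
  exact ⟨F, hF⟩

lemma apply_pow (ρ : G →* PSL(2, ℂ)) (i : ι) : ρ (x i) ^ N i = 1 := by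
  rw [← map_pow, h.pow_eq_one, map_one]

lemma range_param {k : ι → ℕ} (hk : ∀ i, k i ≤ N i / 2) {F : (ι × Fin 3 → ℂ) → G →* PSL(2, ℂ)}
    (hF : ∀ v i, F v (x i) = (classParam (N i) (k i) fun j => v (i, j) : SL(2, ℂ))) :
    Set.range F = component x N k := by
  ext ρ
  constructor
  · rintro ⟨v, rfl⟩ i
    rw [hF, evenLift_coe trSq_neg, trSq_classParam]
  · intro hρ
    choose v hv using fun i =>
      exists_classParam_eq_of_trSq (h.ne_zero i) (h.apply_pow ρ i) (hk i) (hρ i)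
    exact ⟨fun e => v e.1 e.2, h.hom_ext _ _ fun i => by rw [hF, ← hv]⟩

lemma isIrreducible_component [Finite ι] {k : ι → ℕ} (hk : ∀ i, k i ≤ N i / 2) :
    @IsIrreducible _ (zariskiTopology (regularRep x)) (component x N k) := by
  obtain ⟨F, hF⟩ := h.exists_param k
  rw [← h.range_param hk hF]
  refine isIrreducible_range_of_polynomial _ F fun f hf => ?_
  let P : Subalgebra ℂ ((ι × Fin 3 → ℂ) → ℂ) :=
    (MvPolynomial.aeval fun (e : ι × Fin 3) (v : ι × Fin 3 → ℂ) => v e).range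
  have hfP : f ∘ F ∈ P := comp_mem_of_regularRep (fun i => entriesIn_conjParam
    (fun j => show (fun v : ι × Fin 3 → ℂ => v (i, j)) ∈ P from
      ⟨MvPolynomial.X (i, j), MvPolynomial.aeval_X _ _⟩) _) hF hf
  obtain ⟨p, hp⟩ := hfP
  refine ⟨p, fun v => ?_⟩
  have h1 : ∀ p : MvPolynomial (ι × Fin 3) ℂ,
      MvPolynomial.aeval (fun (e : ι × Fin 3) (v : ι × Fin 3 → ℂ) => v e) p v =
        MvPolynomial.eval v p := by
    intro p
    induction p using MvPolynomial.induction_on with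
    | C a => simp
    | add p q hp hq => simp [hp, hq]
    | mul_X p i hp => simp [hp]
  rw [← h1 p]
  exact (congrFun hp v).symm

/-- Coordinates are free only on nontrivial factors, where `exists_matrix` supplies a matrix of the
right trace; a factor with `k i = 0` is a single point. -/
lemma exists_mem_component_coord {k : ι → ℕ} (hk : ∀ i, k i ≤ N i / 2) (z : ι × Bool → ℂ) :
    ∃ ρ ∈ component x N k, ∀ i, k i ≠ 0 → ∀ b, coord x (i, b) ρ = z (i, b) := by
  have hA : ∀ i, ∃ v, k i ≠ 0 → diagSq (classParam (N i) (k i) v) = z (i, true) ∧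
      offDiagSq (classParam (N i) (k i) v) = z (i, false) := by
    intro i
    by_cases hki : k i = 0
    · exact ⟨0, fun h => absurd hki h⟩
    obtain ⟨A, hA, h1, h2⟩ := exists_matrix
      (((halfRoot (N i) ^ k i : ℂˣ) : ℂ) + ((halfRoot (N i) ^ k i)⁻¹ : ℂˣ))
      (z (i, true)) (z (i, false))
    obtain ⟨v, rfl⟩ := exists_conjParam_eq (classParam_sq_ne_one (h.ne_zero i) (hk i) hki) hA
    exact ⟨v, fun _ => ⟨h1, h2⟩⟩
  choose v hv using hA
  obtain ⟨F, hF⟩ := h.exists_param k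
  refine ⟨F fun e => v e.1 e.2, h.range_param hk hF ▸ ⟨_, rfl⟩, fun i hi b => ?_⟩
  rw [coord, hF]
  cases b
  · exact (evenLift_coe offDiagSq_neg _).trans (hv i hi).2
  · exact (evenLift_coe diagSq_neg _).trans (hv i hi).1

lemma dim_component [Finite ι] {k : ι → ℕ} (hk : ∀ i, k i ≤ N i / 2) :
    dim (restrict (regularRep x) (component x N k)) =
      ((Nat.card {i // k i ≠ 0} * 2 : ℕ) : WithBot ℕ∞) := by
  obtain ⟨F, hF⟩ := h.exists_param k
  have hrange := h.range_param hk hF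
  let F' : (ι × Fin 3 → ℂ) → component x N k := fun v => ⟨F v, hrange ▸ ⟨v, rfl⟩⟩
  have hF' : Function.Surjective F' := by
    rintro ⟨ρ, hρ⟩
    obtain ⟨v, rfl⟩ := hrange.symm ▸ hρ
    exact ⟨v, rfl⟩
  let u : {i // k i ≠ 0} × Bool → component x N k → ℂ := fun e ρ => coord x (e.1, e.2) ρ
  have hu : ∀ e, u e ∈ restrict (regularRep x) (component x N k) := fun e =>
    Subalgebra.mem_map.2 ⟨_, coord_mem x (e.1, e.2), rfl⟩
  rw [dim_eq_card_of_isIntegral _ F' hF' u hu]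
  · simp [Nat.card_prod]
  · intro z
    classical
    obtain ⟨ρ, hρ, hz⟩ := h.exists_mem_component_coord hk
      (fun e => if he : k e.1 ≠ 0 then z (⟨e.1, he⟩, e.2) else 0)
    refine ⟨⟨ρ, hρ⟩, ?_⟩
    rintro ⟨⟨i, hi⟩, b⟩
    simp [u, hz i hi b, hi]
  · rintro _ ⟨f, hf, rfl⟩
    change f ∘ F ∈ (integralClosure _ _).restrictScalars ℂ
    refine comp_mem_of_regularRep (fun i => ?_) hF hf
    by_cases hki : k i = 0
    · have : (fun v : ι × Fin 3 → ℂ => classParam (N i) (k i) fun j => v (i, j)) = fun _ => 1 := by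
        funext v
        rw [classParam, hki, pow_zero, conjParam_one]
      rw [this]
      exact EntriesIn.const 1
    · exact entriesIn_of_coord hF i (fun b => Algebra.subset_adjoin ⟨(⟨i, hki⟩, b), rfl⟩)
        {classTrSq (N i) (k i)} fun v => by rw [trSq_classParam]; exact Finset.mem_singleton_self _

/-- The squared traces take finitely many values on the whole variety, so the normalisation used on
one component works globally. Integrality is tested on the set `Y` of all matrix lifts, as no single
parametrisation covers every component. -/
lemma dim_regularRep [Finite ι] :
    dim (regularRep x) = ((Nat.card ι * 2 : ℕ) : WithBot ℕ∞) := by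
  let Y := {s : ι → SL(2, ℂ) // ∀ i, (s i : PSL(2, ℂ)) ^ N i = 1}
  choose F hF using fun s : Y => h.exists_hom (fun i => (s.1 i : PSL(2, ℂ))) s.2
  have hFs : Function.Surjective F := by
    intro ρ
    choose s hs using fun i => QuotientGroup.mk_surjective (ρ (x i))
    refine ⟨⟨s, fun i => (congrArg (· ^ N i) (hs i)).trans (h.apply_pow ρ i)⟩,
      h.hom_ext _ _ fun i => ?_⟩
    rw [hF]
    exact hs i
  rw [dim_eq_card_of_isIntegral (σ := ι × Bool) _ F hFs (coord x) (coord_mem x)]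
  · simp [Nat.card_prod]
  · intro z
    -- The class `k = 1` is available in every factor because `N i ≥ 2`, so one component already
    -- realises all coordinate values.
    obtain ⟨ρ, -, hz⟩ := h.exists_mem_component_coord (k := fun _ => 1)
      (fun i => by have := h.two_le i; omega) z
    exact ⟨ρ, fun e => hz e.1 one_ne_zero e.2⟩
  · intro f hf
    change f ∘ F ∈ (integralClosure _ _).restrictScalars ℂ
    refine comp_mem_of_regularRep (g := fun s : Y => s.1) (fun i => ?_) hF hf
    refine entriesIn_of_coord hF i (fun b => Algebra.subset_adjoin ⟨(i, b), rfl⟩)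
      ((Finset.range (N i / 2 + 1)).image (classTrSq (N i))) fun s => ?_
    obtain ⟨k, hk, v, hv⟩ := exists_classParam_eq (h.ne_zero i) (s.2 i)
    rw [← evenLift_coe trSq_neg, ← hv, evenLift_coe trSq_neg, trSq_classParam]
    exact Finset.mem_image_of_mem _ (Finset.mem_range.2 (by omega))

lemma components_regularRep [Finite ι] : components (regularRep x) =
    Set.range fun k : ∀ i, Fin (N i / 2 + 1) => component x N fun i => k i := by
  refine @irreducibleComponents_eq_range _ _ _ (zariskiTopology (regularRep x)) _
    (fun k => isClosed_component x N _)
    (fun k => h.isIrreducible_component fun i => Nat.le_of_lt_succ (k i).2) ?_ ?_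
  · refine Set.eq_univ_of_forall fun ρ => Set.mem_iUnion.2 ?_
    choose k hk v hv using fun i => exists_classParam_eq (h.ne_zero i) (h.apply_pow ρ i)
    refine ⟨fun i => ⟨k i, Nat.lt_succ_of_le (hk i)⟩, fun i => ?_⟩
    rw [← hv, evenLift_coe trSq_neg, trSq_classParam]
  · intro k l hkl
    refine Set.disjoint_left.2 fun ρ hk hl => hkl (funext fun i => Fin.ext ?_)
    exact classTrSq_injOn (h.ne_zero i) (Nat.le_of_lt_succ (k i).2) (Nat.le_of_lt_succ (l i).2)
      ((hk i).symm.trans (hl i))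

/-- Components are nonempty and their squared traces recover `k`, so counting components amounts to
counting indices. -/
lemma component_injective : Function.Injective
    fun k : ∀ i, Fin (N i / 2 + 1) => component x N fun i => k i := by
  intro k l hkl
  obtain ⟨ρ, hρ, -⟩ := h.exists_mem_component_coord (k := fun i => k i)
    (fun i => Nat.le_of_lt_succ (k i).2) 0
  have hρ' : ρ ∈ component x N fun i => l i := Set.mem_of_mem_of_subset hρ (Eq.subset hkl)
  refine funext fun i => Fin.ext ?_
  exact classTrSq_injOn (h.ne_zero i) (Nat.le_of_lt_succ (k i).2) (Nat.le_of_lt_succ (l i).2)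
    ((hρ i).symm.trans (hρ' i))

lemma numComponents_eq [Finite ι] (d : ℕ) : numComponents (regularRep x) d =
    {k : ∀ i, Fin (N i / 2 + 1) | Nat.card {i // k i ≠ 0} * 2 = d}.encard := by
  rw [numComponents, ← h.component_injective.encard_image]
  congr 1
  ext Z
  rw [Set.mem_ofPred_eq, h.components_regularRep]
  have hd : ∀ k : ∀ i, Fin (N i / 2 + 1),
      dim (restrict (regularRep x) (component x N fun i => k i)) = (d : WithBot ℕ∞) ↔
        Nat.card {i // k i ≠ 0} * 2 = d := by
    intro k
    rw [h.dim_component fun i => Nat.le_of_lt_succ (k i).2]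
    simp only [← Fin.val_ne_zero_iff]
    norm_cast
  constructor
  · rintro ⟨⟨k, rfl⟩, hk⟩
    exact ⟨k, (hd k).1 hk, rfl⟩
  · rintro ⟨k, hk, rfl⟩
    exact ⟨⟨k, rfl⟩, (hd k).2 hk⟩

end IsCyclicFreeBasis

end Components

/-! ### The free product of two cyclic groups and the final count -/

section FreeProduct

variable (m n : ℕ)

/-- The canonical generators of the free product of two cyclic groups. -/
def cyclicGen : Fin 2 → Monoid.Coprod (Multiplicative (ZMod m)) (Multiplicative (ZMod n)) :=
  ![Monoid.Coprod.inl (.ofAdd 1), Monoid.Coprod.inr (.ofAdd 1)]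

lemma mem_zpowers_ofAdd_one (m : ℕ) (a : Multiplicative (ZMod m)) :
    a ∈ Subgroup.zpowers (Multiplicative.ofAdd (1 : ZMod m)) := by
  obtain ⟨k, hk⟩ := ZMod.intCast_surjective a.toAdd
  refine ⟨k, ?_⟩
  change Multiplicative.ofAdd (1 : ZMod m) ^ k = a
  rw [← ofAdd_zsmul, zsmul_one, hk]
  rfl

lemma exists_hom_ofAdd_one {H : Type*} [Group H] {m : ℕ} {A : H} (hA : A ^ m = 1) :
    ∃ f : Multiplicative (ZMod m) →* H, f (.ofAdd 1) = A := by
  refine ⟨monoidHomOfForallMemZpowers (mem_zpowers_ofAdd_one m) (g' := A) ?_,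
    monoidHomOfForallMemZpowers_apply_gen _ _⟩
  rw [orderOf_ofAdd_eq_addOrderOf, ZMod.addOrderOf_one]
  exact orderOf_dvd_of_pow_eq_one hA

lemma hom_ext_ofAdd_one {H : Type*} [Group H] {m : ℕ} {f g : Multiplicative (ZMod m) →* H}
    (h : f (.ofAdd 1) = g (.ofAdd 1)) : f = g := by
  refine MonoidHom.ext fun a => ?_
  obtain ⟨k, rfl⟩ := mem_zpowers_ofAdd_one m a
  simp [h]

lemma closure_cyclicGen : Subgroup.closure (Set.range (cyclicGen m n)) = ⊤ := by
  rw [eq_top_iff]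
  intro g _
  have key : ∀ (k : ℤ) (c : Fin 2),
      cyclicGen m n c ^ k ∈ Subgroup.closure (Set.range (cyclicGen m n)) :=
    fun k c => Subgroup.zpow_mem _ (Subgroup.subset_closure (Set.mem_range_self c)) k
  induction g using Monoid.Coprod.induction_on with
  | inl a =>
    obtain ⟨k, rfl⟩ := mem_zpowers_ofAdd_one m a
    simpa [cyclicGen] using key k 0
  | inr a =>
    obtain ⟨k, rfl⟩ := mem_zpowers_ofAdd_one n a
    simpa [cyclicGen] using key k 1
  | mul a b ha hb => exact Subgroup.mul_mem _ (ha trivial) (hb trivial)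

variable {m n}

lemma isCyclicFreeBasis_cyclicGen (hm : 2 ≤ m) (hn : 2 ≤ n) :
    IsCyclicFreeBasis (cyclicGen m n) ![m, n] where
  two_le i := by fin_cases i <;> assumption
  pow_eq_one i := by
    have h : ∀ k : ℕ, Multiplicative.ofAdd (1 : ZMod k) ^ k = 1 := fun k => by
      rw [← ofAdd_nsmul, nsmul_one, ZMod.natCast_self, ofAdd_zero]
    fin_cases i
    · simp [cyclicGen, ← map_pow, h]
    · simp [cyclicGen, ← map_pow, h]
  hom_ext ρ σ h := Monoid.Coprod.hom_ext (hom_ext_ofAdd_one (h 0)) (hom_ext_ofAdd_one (h 1))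
  exists_hom A hA := by
    obtain ⟨f, hf⟩ := exists_hom_ofAdd_one (m := m) (hA 0)
    obtain ⟨g, hg⟩ := exists_hom_ofAdd_one (m := n) (hA 1)
    refine ⟨Monoid.Coprod.lift f g, fun i => ?_⟩
    fin_cases i
    · exact (Monoid.Coprod.lift_apply_inl f g _).trans hf
    · exact (Monoid.Coprod.lift_apply_inr f g _).trans hg

lemma natCard_ne_zero_fin_two {a : Fin 2 → ℕ} (k : ∀ i, Fin (a i + 1)) :
    Nat.card {i // k i ≠ 0} = (if k 0 = 0 then 0 else 1) + (if k 1 = 0 then 0 else 1) := by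
  classical
  rw [Nat.card_eq_fintype_card, Fintype.card_subtype, Finset.card_filter, Fin.sum_univ_two]
  simp [ite_not]

lemma encard_pi_fin_two {a : Fin 2 → ℕ} (p : Fin (a 0 + 1) → Fin (a 1 + 1) → Prop)
    [∀ k l, Decidable (p k l)] :
    {k : ∀ i, Fin (a i + 1) | p (k 0) (k 1)}.encard =
      ((∑ k, ∑ l, if p k l then 1 else 0 : ℕ) : ℕ∞) := by
  rw [← Fintype.sum_prod_type', ← Finset.card_filter, ← Set.encard_coe_eq_coe_finsetCard,
    ← (piFinTwoEquiv fun i => Fin (a i + 1)).injective.encard_image]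
  congr 1
  ext ⟨k, l⟩
  simp only [Set.mem_image, Finset.coe_filter, Finset.mem_univ, true_and]
  constructor
  · rintro ⟨f, hf, h⟩
    simp only [piFinTwoEquiv_apply, Prod.mk.injEq] at h
    rw [← h.1, ← h.2]
    exact hf
  · exact fun hp => ⟨(piFinTwoEquiv _).symm (k, l), hp, Equiv.apply_symm_apply _ _⟩

lemma profile_eq {G : Type*} [Group G] {x : Fin 2 → G} {N : Fin 2 → ℕ}
    (h : IsCyclicFreeBasis x N) : profile (regularRep x) 4 =
      ![((N 0 / 2 * (N 1 / 2) : ℕ) : ℕ∞), 0, ((N 0 / 2 + N 1 / 2 : ℕ) : ℕ∞), 0, 1] := by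
  have key : ∀ d, numComponents (regularRep x) d =
      ((∑ k : Fin (N 0 / 2 + 1), ∑ l : Fin (N 1 / 2 + 1),
        if ((if k = 0 then 0 else 1) + (if l = 0 then 0 else 1)) * 2 = d then 1 else 0 : ℕ) : ℕ∞) := by
    intro d
    rw [h.numComponents_eq]
    simp_rw [natCard_ne_zero_fin_two (a := fun i => N i / 2)]
    exact encard_pi_fin_two (a := fun i => N i / 2)
      fun k l => ((if k = 0 then 0 else 1) + (if l = 0 then 0 else 1)) * 2 = d
  have hp : profile (regularRep x) 4 = ![numComponents (regularRep x) 4,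
      numComponents (regularRep x) 3, numComponents (regularRep x) 2,
      numComponents (regularRep x) 1, numComponents (regularRep x) 0] := by
    funext j
    fin_cases j <;> rfl
  rw [hp]
  simp only [key]
  generalize N 0 / 2 = a
  generalize N 1 / 2 = b
  -- Splitting each sum at index `0` separates the trivial class from the `a` or `b` others;
  -- `Finset.sum_boole` would turn the sums into cardinalities first.
  simp [-Finset.sum_boole, Fin.sum_univ_succ, Fin.succ_ne_zero, add_comm]

end FreeProduct

end RepProfile
end

theorem theorem4p5 (m n : ℕ) (hm : 2 ≤ m) (hn : 2 ≤ n) (k : ℕ)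
    (x : Fin k → Monoid.Coprod (Multiplicative (ZMod m)) (Multiplicative (ZMod n)))
    (hx : Subgroup.closure (Set.range x) = ⊤) :
    RepProfile.dim (RepProfile.regularRep x) = 4 ∧
    (Even m → Even n → RepProfile.profile (RepProfile.regularRep x) 4 =
      ![((m * n / 4 : ℕ) : ℕ∞), 0, (((m + n) / 2 : ℕ) : ℕ∞), 0, 1]) ∧
    (Odd m → Even n → RepProfile.profile (RepProfile.regularRep x) 4 =
      ![((n * (m - 1) / 4 : ℕ) : ℕ∞), 0, (((m + n - 1) / 2 : ℕ) : ℕ∞), 0, 1]) ∧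
    (Even m → Odd n → RepProfile.profile (RepProfile.regularRep x) 4 =
      ![((m * (n - 1) / 4 : ℕ) : ℕ∞), 0, (((m + n - 1) / 2 : ℕ) : ℕ∞), 0, 1]) ∧
    (Odd m → Odd n → RepProfile.profile (RepProfile.regularRep x) 4 =
      ![(((m - 1) * (n - 1) / 4 : ℕ) : ℕ∞), 0, (((m + n - 2) / 2 : ℕ) : ℕ∞), 0, 1]) := by
  have h := RepProfile.isCyclicFreeBasis_cyclicGen hm hn
  rw [RepProfile.regularRep_eq_of_closure_eq_top hx (RepProfile.closure_cyclicGen m n)]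
  have hp := RepProfile.profile_eq h
  simp only [Matrix.cons_val_zero, Matrix.cons_val_one] at hp
  have hprod : ∀ a b : ℕ, 2 * a * (2 * b) / 4 = a * b := fun a b => by
    rw [show 2 * a * (2 * b) = 4 * (a * b) by ring, Nat.mul_div_cancel_left _ (by norm_num)]
  -- In all parity cases the numerators are `4ab` and `2(a + b)` with `a = m / 2`, `b = n / 2`, so
  -- the truncated divisions are exact.
  have hfin : ∀ a b p s : ℕ, m / 2 = a → n / 2 = b → p = 2 * a * (2 * b) → s / 2 = a + b →
      RepProfile.profile (RepProfile.regularRep (RepProfile.cyclicGen m n)) 4 =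
        ![((p / 4 : ℕ) : ℕ∞), 0, ((s / 2 : ℕ) : ℕ∞), 0, 1] := by
    rintro a b p s rfl rfl rfl hs
    rw [hp, hprod, hs]
  refine ⟨?_, ?_, ?_, ?_, ?_⟩
  · rw [h.dim_regularRep]
    simp
  · rintro ⟨a, rfl⟩ ⟨b, rfl⟩
    exact hfin a b _ _ (by omega) (by omega) (by ring) (by omega)
  · rintro ⟨a, rfl⟩ ⟨b, rfl⟩
    exact hfin a b _ _ (by omega) (by omega) (by rw [Nat.add_sub_cancel]; ring) (by omega)
  · rintro ⟨a, rfl⟩ ⟨b, rfl⟩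
    exact hfin a b _ _ (by omega) (by omega) (by rw [Nat.add_sub_cancel]; ring) (by omega)
  · rintro ⟨a, rfl⟩ ⟨b, rfl⟩
    exact hfin a b _ _ (by omega) (by omega)
      (by rw [Nat.add_sub_cancel, Nat.add_sub_cancel]) (by omega)
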